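/- Let $\mathsf{PA}$ be first-order Peano Arithmetic, with a standard primitive recursive Gödel numbering $\ulcorner\cdot\urcorner$ of formulas and derivations. Let $u:w$ denote the arithmetical formula expressing the primitive recursive proof predicate "$u$ is the code of a $\mathsf{PA}$-derivation of the formula with code $w$", and let $\bot$ be the sentence $0=1$. A serial property is a sequence $\mathcal F=\{F_0,F_1,F_2,\dots\}$ of arithmetical sentences together with a primitive recursive term $F^\bullet(x)$ such that $F^\bullet(n)=\ulcorner F_n\urcorner$ for every $n$. A selector proof of $\mathcal F$ in $\mathsf{PA}$ is a pair $\langle s,v\rangle$ in which $s(x)$ is a primitive recursive term (the selector) and $v$ is a $\mathsf{PA}$-derivation of $\forall x\,[\,s(x):F^\bullet(x)\,]$ (the verifier); $\mathcal F$ is provable in $\mathsf{PA}$ if it has a selector proof in $\mathsf{PA}$. Then the following hold. (1) Proving serial properties does not add any new theorems to $\mathsf{PA}$: if a serial property $\mathcal F=\{F_0,F_1,F_2,\dots\}$ is provable in $\mathsf{PA}$, then $\mathsf{PA}\vdash F_n$ for every $n=0,1,2,\dots$. (2) $\mathsf{PA}$ does not prove any serial property that contains $\bot$: if $F_n=\bot$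 for some $n$, then $\mathcal F$ has no selector proof in $\mathsf{PA}$. -/

import Mathlib

namespace PeanoArith

/-! ### Syntax of first-order arithmetic

The language has `0`, `S`, `+`, `*` and equality; variables are `x₀, x₁, x₂, …`. -/

/-- Terms of the language of arithmetic. -/
inductive Tm : Type
  | var : ℕ → Tm
  | zero : Tm
  | succ : Tm → Tm
  | add : Tm → Tm → Tm
  | mul : Tm → Tm → Tm

/-- Formulas of the language of arithmetic; `all k φ` is `∀ x_k, φ`. -/
inductive Fml : Type
  | eq : Tm → Tm → Fml
  | neg : Fml → Fml
  | imp : Fml → Fml → Fml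
  | all : ℕ → Fml → Fml

namespace Tm

/-- The variables of a term. -/
def vars : Tm → Finset ℕ
  | var k => {k}
  | zero => ∅
  | succ t => t.vars
  | add t u => t.vars ∪ u.vars
  | mul t u => t.vars ∪ u.vars

/-- `u.subst k t` is `u` with `t` substituted for `x_k`. -/
def subst : Tm → ℕ → Tm → Tm
  | var j, k, t => if j = k then t else var j
  | zero, _, _ => zero
  | succ u, k, t => succ (u.subst k t)
  | add u v, k, t => add (u.subst k t) (v.subst k t)
  | mul u v, k, t => mul (u.subst k t) (v.subst k t)

/-- Gödel numbers of terms (`Nat.pair` is the Cantor pairing function). -/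
def code : Tm → ℕ
  | var k => Nat.pair 0 k
  | zero => Nat.pair 1 0
  | succ t => Nat.pair 2 t.code
  | add t u => Nat.pair 3 (Nat.pair t.code u.code)
  | mul t u => Nat.pair 4 (Nat.pair t.code u.code)

end Tm

namespace Fml

/-- The free variables of a formula. -/
def fv : Fml → Finset ℕ
  | eq t u => t.vars ∪ u.vars
  | neg φ => φ.fv
  | imp φ ψ => φ.fv ∪ ψ.fv
  | all k φ => φ.fv.erase k

/-- A sentence is a formula without free variables. -/
def IsSentence (φ : Fml) : Prop := φ.fv = ∅

/-- `φ.subst k t` is `φ` with `t` substituted for the free occurrences of `x_k`. -/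
def subst (k : ℕ) (t : Tm) : Fml → Fml
  | eq u v => eq (u.subst k t) (v.subst k t)
  | neg φ => neg (φ.subst k t)
  | imp φ ψ => imp (φ.subst k t) (ψ.subst k t)
  | all j φ => if j = k then all j φ else all j (φ.subst k t)

/-- `φ.FreeFor k t`: the term `t` is free for `x_k` in `φ`, i.e. no variable of `t` becomes bound
when `t` is substituted for the free occurrences of `x_k` in `φ`. -/
def FreeFor (k : ℕ) (t : Tm) : Fml → Prop
  | eq _ _ => True
  | neg φ => φ.FreeFor k t
  | imp φ ψ => φ.FreeFor k t ∧ ψ.FreeFor k t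
  | all j φ => k ∉ (all j φ).fv ∨ (j ∉ t.vars ∧ φ.FreeFor k t)

/-- Gödel numbers of formulas. -/
def code : Fml → ℕ
  | eq t u => Nat.pair 0 (Nat.pair t.code u.code)
  | neg φ => Nat.pair 1 φ.code
  | imp φ ψ => Nat.pair 2 (Nat.pair φ.code ψ.code)
  | all k φ => Nat.pair 3 (Nat.pair k φ.code)

/-- Falsum is the standard arithmetical contradiction `0 = 1`. -/
def bot : Fml := eq Tm.zero (Tm.succ Tm.zero)

def and (φ ψ : Fml) : Fml := neg (imp φ (neg ψ))

def or (φ ψ : Fml) : Fml := imp (neg φ) ψ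

/-- `ex k φ` is `∃ x_k, φ`. -/
def ex (k : ℕ) (φ : Fml) : Fml := neg (all k (neg φ))

end Fml

/-! ### Peano Arithmetic -/

/-- `Derivation φ` is the type of formal derivations of `φ` in Peano Arithmetic, presented as a
Hilbert-style calculus: classical first-order logic with equality, the usual axioms for `0`, `S`,
`+`, `*`, and induction for all formulas. The rules are modus ponens and generalization. -/
inductive Derivation : Fml → Type
  | ax1 (φ ψ : Fml) : Derivation (.imp φ (.imp ψ φ))
  | ax2 (φ ψ χ : Fml) :
      Derivation (.imp (.imp φ (.imp ψ χ)) (.imp (.imp φ ψ) (.imp φ χ)))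
  | ax3 (φ ψ : Fml) : Derivation (.imp (.imp (.neg ψ) (.neg φ)) (.imp φ ψ))
  | inst (k : ℕ) (t : Tm) (φ : Fml) (h : φ.FreeFor k t) :
      Derivation (.imp (.all k φ) (φ.subst k t))
  | dist (k : ℕ) (φ ψ : Fml) (h : k ∉ φ.fv) :
      Derivation (.imp (.all k (.imp φ ψ)) (.imp φ (.all k ψ)))
  | refl (t : Tm) : Derivation (.eq t t)
  | leibniz (k : ℕ) (t u : Tm) (φ : Fml) (ht : φ.FreeFor k t) (hu : φ.FreeFor k u) :
      Derivation (.imp (.eq t u) (.imp (φ.subst k t) (φ.subst k u)))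
  | succ_ne_zero : Derivation (.neg (.eq (.succ (.var 0)) .zero))
  | succ_inj : Derivation
      (.imp (.eq (.succ (.var 0)) (.succ (.var 1))) (.eq (.var 0) (.var 1)))
  | add_zero : Derivation (.eq (.add (.var 0) .zero) (.var 0))
  | add_succ : Derivation
      (.eq (.add (.var 0) (.succ (.var 1))) (.succ (.add (.var 0) (.var 1))))
  | mul_zero : Derivation (.eq (.mul (.var 0) .zero) .zero)
  | mul_succ : Derivation
      (.eq (.mul (.var 0) (.succ (.var 1))) (.add (.mul (.var 0) (.var 1)) (.var 0)))
  | induction (k : ℕ) (φ : Fml) :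
      Derivation (.imp (φ.subst k .zero)
        (.imp (.all k (.imp φ (φ.subst k (.succ (.var k))))) (.all k φ)))
  | mp {φ ψ : Fml} (d : Derivation (.imp φ ψ)) (e : Derivation φ) : Derivation ψ
  | gen (k : ℕ) {φ : Fml} (d : Derivation φ) : Derivation (.all k φ)

/-- `PA ⊢ φ`. -/
def Provable (φ : Fml) : Prop := Nonempty (Derivation φ)

/-- Gödel numbers of derivations. -/
def Derivation.code : {φ : Fml} → Derivation φ → ℕ
  | _, .ax1 φ ψ => Nat.pair 0 (Nat.pair φ.code ψ.code)
  | _, .ax2 φ ψ χ => Nat.pair 1 (Nat.pair φ.code (Nat.pair ψ.code χ.code))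
  | _, .ax3 φ ψ => Nat.pair 2 (Nat.pair φ.code ψ.code)
  | _, .inst k t φ _ => Nat.pair 3 (Nat.pair k (Nat.pair t.code φ.code))
  | _, .dist k φ ψ _ => Nat.pair 4 (Nat.pair k (Nat.pair φ.code ψ.code))
  | _, .refl t => Nat.pair 5 t.code
  | _, .leibniz k t u φ _ _ =>
      Nat.pair 6 (Nat.pair k (Nat.pair t.code (Nat.pair u.code φ.code)))
  | _, .succ_ne_zero => Nat.pair 7 0
  | _, .succ_inj => Nat.pair 8 0
  | _, .add_zero => Nat.pair 9 0
  | _, .add_succ => Nat.pair 10 0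
  | _, .mul_zero => Nat.pair 11 0
  | _, .mul_succ => Nat.pair 12 0
  | _, .induction k φ => Nat.pair 13 (Nat.pair k φ.code)
  | _, .mp d e => Nat.pair 14 (Nat.pair d.code e.code)
  | _, .gen k d => Nat.pair 15 (Nat.pair k d.code)

/-! ### Primitive recursive terms -/

/-- Primitive recursive terms in one argument; several arguments are passed through `Nat.pair`.
The clauses are those of Mathlib's `Nat.Primrec`. -/
inductive PR : Type
  | zero : PR
  | succ : PR
  | left : PR
  | right : PR
  | pair : PR → PR → PR
  | comp : PR → PR → PR
  | prec : PR → PR → PR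

namespace PR

/-- The primitive recursive function denoted by a primitive recursive term. -/
def eval : PR → ℕ → ℕ
  | zero, _ => 0
  | succ, n => n + 1
  | left, n => n.unpair.1
  | right, n => n.unpair.2
  | pair f g, n => Nat.pair (f.eval n) (g.eval n)
  | comp f g, n => f.eval (g.eval n)
  | prec f g, n =>
      Nat.rec (f.eval n.unpair.1)
        (fun y r => g.eval (Nat.pair n.unpair.1 (Nat.pair y r))) n.unpair.2

/-- The functions denoted by primitive recursive terms are the primitive recursive functions. -/
theorem primrec_iff (f : ℕ → ℕ) : Nat.Primrec f ↔ ∃ c : PR, c.eval = f := by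
  constructor
  · intro h
    induction h with
    | zero => exact ⟨zero, rfl⟩
    | succ => exact ⟨succ, rfl⟩
    | left => exact ⟨left, rfl⟩
    | right => exact ⟨right, rfl⟩
    | pair _ _ ihf ihg =>
      obtain ⟨c, rfl⟩ := ihf
      obtain ⟨d, rfl⟩ := ihg
      exact ⟨pair c d, rfl⟩
    | comp _ _ ihf ihg =>
      obtain ⟨c, rfl⟩ := ihf
      obtain ⟨d, rfl⟩ := ihg
      exact ⟨comp c d, rfl⟩
    | prec _ _ ihf ihg =>
      obtain ⟨c, rfl⟩ := ihf
      obtain ⟨d, rfl⟩ := ihg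
      exact ⟨prec c d, rfl⟩
  · rintro ⟨c, rfl⟩
    induction c with
    | zero => exact .zero
    | succ => exact .succ
    | left => exact .left
    | right => exact .right
    | pair _ _ ihf ihg => exact (Nat.Primrec.pair ihf ihg).of_eq fun _ => rfl
    | comp _ _ ihf ihg => exact (Nat.Primrec.comp ihf ihg).of_eq fun _ => rfl
    | prec _ _ ihf ihg => exact (Nat.Primrec.prec ihf ihg).of_eq fun _ => rfl

/-! Combinators. Below, `f`, `g`, … are terms in a common argument. -/

/-- The identity. -/
def id : PR := pair left right

/-- The constant function with value `k`. -/
def num : ℕ → PR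
  | 0 => zero
  | k + 1 => comp succ (num k)

def pred (f : PR) : PR := comp (prec zero (comp left right)) (pair zero f)

def add (f g : PR) : PR := comp (prec id (comp succ (comp right right))) (pair f g)

/-- Truncated subtraction. -/
def sub (f g : PR) : PR := comp (prec id (pred (comp right right))) (pair f g)

/-- `1` if `f` and `g` agree, `0` otherwise. -/
def eqv (f g : PR) : PR := sub (num 1) (add (sub f g) (sub g f))

/-- `g` if `c` is nonzero, `h` otherwise. -/
def ite (c g h : PR) : PR := comp (prec h (comp g left)) (pair id c)

/-- Conjunction, disjunction and negation of truth values (`0` is false). -/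
def conj (f g : PR) : PR := ite f g zero
def disj (f g : PR) : PR := ite f (num 1) g
def neg (f : PR) : PR := ite f zero (num 1)

/-- `switch t i [c₀, c₁, …]` is `c_j` if `t = i + j`, and `0` if there is no such entry. -/
def switch (t : PR) : ℕ → List PR → PR
  | _, [] => zero
  | i, c :: cs => ite (eqv t (num i)) c (switch t (i + 1) cs)

/-- Course-of-values recursion: `(cov G).eval ⟨a, n⟩ = G.eval ⟨a, ⟨n, T⟩⟩`, where
`T = ⟨h (n-1), ⟨h (n-2), … ⟨h 0, 0⟩ … ⟩⟩` and `h i = (cov G).eval ⟨a, i⟩`. -/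
def cov (G : PR) : PR :=
  comp left (comp (prec zero (pair G (comp right right))) (pair left (comp succ right)))

/-! The parts of the argument `⟨a, ⟨n, T⟩⟩` of the step of a course-of-values recursion; `n` is
usually a code `⟨tag, body⟩`. -/

/-- The parameter `a`. -/
def prm : PR := left

/-- The recursion argument `n`. -/
def arg : PR := comp left right

def tag : PR := comp left arg
def body : PR := comp right arg
def body1 : PR := comp left body
def body2 : PR := comp right body
def body21 : PR := comp left body2
def body22 : PR := comp right body2
def body221 : PR := comp left body22
def body222 : PR := comp right body22

/-- The earlier value `h i`, read off from the table `T`, where `i < n` is the value of `e`. -/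
def prev (e : PR) : PR :=
  comp left (comp (prec id (comp right (comp right right)))
    (pair (comp right right) (sub (pred arg) e)))

/-! The constructors of terms and formulas, on codes. -/

def mkVar (k : PR) : PR := pair (num 0) k
def mkZero : PR := pair (num 1) (num 0)
def mkSucc (t : PR) : PR := pair (num 2) t
def mkAdd (t u : PR) : PR := pair (num 3) (pair t u)
def mkMul (t u : PR) : PR := pair (num 4) (pair t u)
def mkEq (t u : PR) : PR := pair (num 0) (pair t u)
def mkNeg (p : PR) : PR := pair (num 1) p
def mkImp (p q : PR) : PR := pair (num 2) (pair p q)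
def mkAll (k p : PR) : PR := pair (num 3) (pair k p)

/-! The syntactic operations, on codes. -/

/-- Is `t` the code of a term? -/
def isTm (t : PR) : PR :=
  comp (cov (switch tag 0
    [num 1,
     eqv body zero,
     prev body,
     conj (prev body1) (prev body2),
     conj (prev body1) (prev body2)])) (pair zero t)

/-- Is `p` the code of a formula? -/
def isFml (p : PR) : PR :=
  comp (cov (switch tag 0
    [conj (isTm body1) (isTm body2),
     prev body,
     conj (prev body1) (prev body2),
     prev body2])) (pair zero p)

/-- Does `x_k` occur in the term `t`? -/
def occTm (k t : PR) : PR :=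
  comp (cov (switch tag 0
    [eqv body prm,
     zero,
     prev body,
     disj (prev body1) (prev body2),
     disj (prev body1) (prev body2)])) (pair k t)

/-- Does `x_k` occur free in the formula `p`? -/
def occFml (k p : PR) : PR :=
  comp (cov (switch tag 0
    [disj (occTm prm body1) (occTm prm body2),
     prev body,
     disj (prev body1) (prev body2),
     conj (neg (eqv body1 prm)) (prev body2)])) (pair k p)

/-- Substitution of the term `t` for `x_k` in the term `u`. -/
def substTm (k t u : PR) : PR :=
  comp (cov (switch tag 0
    [ite (eqv body (comp left prm)) (comp right prm) (mkVar body),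
     mkZero,
     mkSucc (prev body),
     mkAdd (prev body1) (prev body2),
     mkMul (prev body1) (prev body2)])) (pair (pair k t) u)

/-- Substitution of the term `t` for `x_k` in the formula `p`. -/
def substFml (k t p : PR) : PR :=
  comp (cov (switch tag 0
    [mkEq (substTm (comp left prm) (comp right prm) body1)
       (substTm (comp left prm) (comp right prm) body2),
     mkNeg (prev body),
     mkImp (prev body1) (prev body2),
     ite (eqv body1 (comp left prm)) arg (mkAll body1 (prev body2))])) (pair (pair k t) p)

/-- Is the term `t` free for `x_k` in the formula `p`? -/
def freeFor (k t p : PR) : PR :=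
  comp (cov (switch tag 0
    [num 1,
     prev body,
     conj (prev body1) (prev body2),
     disj (neg (occFml (comp left prm) arg))
       (conj (neg (occTm body1 (comp right prm))) (prev body2))])) (pair (pair k t) p)

/-- `p + 1` if the condition `c` holds, `0` otherwise. -/
def guard (c p : PR) : PR := ite c (comp succ p) zero

/-- `concl d` is `⌜φ⌝ + 1` if `d` is the code of a derivation of `φ` in Peano Arithmetic, and `0`
if `d` is not the code of a derivation. -/
def concl (d : PR) : PR :=
  comp (cov (switch tag 0
    [guard (conj (isFml body1) (isFml body2))
       (mkImp body1 (mkImp body2 body1)),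
     guard (conj (isFml body1) (conj (isFml body21) (isFml body22)))
       (mkImp (mkImp body1 (mkImp body21 body22))
         (mkImp (mkImp body1 body21) (mkImp body1 body22))),
     guard (conj (isFml body1) (isFml body2))
       (mkImp (mkImp (mkNeg body2) (mkNeg body1)) (mkImp body1 body2)),
     guard (conj (isTm body21) (conj (isFml body22) (freeFor body1 body21 body22)))
       (mkImp (mkAll body1 body22) (substFml body1 body21 body22)),
     guard (conj (isFml body21) (conj (isFml body22) (neg (occFml body1 body21))))
       (mkImp (mkAll body1 (mkImp body21 body22)) (mkImp body21 (mkAll body1 body22))),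
     guard (isTm body) (mkEq body body),
     guard (conj (isTm body21) (conj (isTm body221) (conj (isFml body222)
         (conj (freeFor body1 body21 body222) (freeFor body1 body221 body222)))))
       (mkImp (mkEq body21 body221)
         (mkImp (substFml body1 body21 body222) (substFml body1 body221 body222))),
     guard (eqv body zero) (mkNeg (mkEq (mkSucc (mkVar (num 0))) mkZero)),
     guard (eqv body zero)
       (mkImp (mkEq (mkSucc (mkVar (num 0))) (mkSucc (mkVar (num 1))))
         (mkEq (mkVar (num 0)) (mkVar (num 1)))),
     guard (eqv body zero) (mkEq (mkAdd (mkVar (num 0)) mkZero) (mkVar (num 0))),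
     guard (eqv body zero)
       (mkEq (mkAdd (mkVar (num 0)) (mkSucc (mkVar (num 1))))
         (mkSucc (mkAdd (mkVar (num 0)) (mkVar (num 1))))),
     guard (eqv body zero) (mkEq (mkMul (mkVar (num 0)) mkZero) mkZero),
     guard (eqv body zero)
       (mkEq (mkMul (mkVar (num 0)) (mkSucc (mkVar (num 1))))
         (mkAdd (mkMul (mkVar (num 0)) (mkVar (num 1))) (mkVar (num 0)))),
     guard (isFml body2)
       (mkImp (substFml body1 mkZero body2)
         (mkImp (mkAll body1 (mkImp body2 (substFml body1 (mkSucc (mkVar body1)) body2)))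
           (mkAll body1 body2))),
     -- modus ponens: `prev body1` is the conclusion `φ → ψ`, `prev body2` the conclusion `φ`
     guard (conj (prev body1) (conj (prev body2)
         (conj (eqv (comp left (pred (prev body1))) (num 2))
           (eqv (comp left (comp right (pred (prev body1)))) (pred (prev body2))))))
       (comp right (comp right (pred (prev body1)))),
     guard (prev body2) (mkAll body1 (pred (prev body2)))])) (pair zero d)

/-- The characteristic function of the proof predicate: the value at `⟨p, y⟩` is `1` if `p` is the
code of a derivation in Peano Arithmetic of the formula with code `y`, and `0` otherwise. -/
def proofChar : PR := eqv (concl left) (comp succ right)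

end PR

/-! ### Primitive recursive terms in the language of arithmetic

In the formulas below `w`, `m` are indices from which on variables are not in use. -/

namespace Fml

/-- `t < u`. -/
def lt (t u : Tm) (w : ℕ) : Fml := ex w (eq (Tm.add t (Tm.succ (Tm.var w))) u)

/-- `t ≤ u`. -/
def le (t u : Tm) (w : ℕ) : Fml := ex w (eq (Tm.add t (Tm.var w)) u)

/-- `z` is the Cantor pair of `t` and `u`. -/
def isPair (z t u : Tm) (w : ℕ) : Fml :=
  or (and (lt t u w) (eq z (Tm.add (Tm.mul u u) t)))
    (and (le u t w) (eq z (Tm.add (Tm.add (Tm.mul t t) t) u)))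

/-- Gödel's beta function: `r` is the remainder of `c` modulo `(j + 1) * d + 1`. -/
def beta (c d j r : Tm) (w : ℕ) : Fml :=
  and (lt r (Tm.succ (Tm.mul (Tm.succ j) d)) w)
    (ex w (eq c (Tm.add (Tm.mul (Tm.var w) (Tm.succ (Tm.mul (Tm.succ j) d))) r)))

end Fml

/-- `c.graph i o m` is the arithmetical formula `c(x_i) = x_o`. The variables `x_i` and `x_o` have
indices below `m`, and the bound variables have indices `≥ m`. In a primitive recursion,
the sequence of intermediate values is coded by the beta function. -/
def PR.graph : PR → ℕ → ℕ → ℕ → Fml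
  | .zero, _, o, _ => .eq (.var o) .zero
  | .succ, i, o, _ => .eq (.var o) (.succ (.var i))
  | .left, i, o, m => .ex m (.isPair (.var i) (.var o) (.var m) (m + 1))
  | .right, i, o, m => .ex m (.isPair (.var i) (.var m) (.var o) (m + 1))
  | .pair f g, i, o, m =>
      .ex m <| .ex (m + 1) <|
        .and (f.graph i m (m + 2)) <|
        .and (g.graph i (m + 1) (m + 2)) <|
        .isPair (.var o) (.var m) (.var (m + 1)) (m + 2)
  | .comp f g, i, o, m => .ex m <| .and (g.graph i m (m + 1)) (f.graph m o (m + 1))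
  | .prec f g, i, o, m =>
      -- `x_i = ⟨a, n⟩`, and `β(c, d, ·)` lists the values at `⟨a, 0⟩, …, ⟨a, n⟩`, where `a`, `n`,
      -- `c`, `d` are the variables with indices `m`, `m + 1`, `m + 2`, `m + 3`
      .ex m <| .ex (m + 1) <| .ex (m + 2) <| .ex (m + 3) <|
        .and (.isPair (.var i) (.var m) (.var (m + 1)) (m + 4)) <|
        .and (.ex (m + 4) <|
          .and (.beta (.var (m + 2)) (.var (m + 3)) .zero (.var (m + 4)) (m + 5))
            (f.graph m (m + 4) (m + 5))) <|
        .and (.all (m + 4) <| .imp (.lt (.var (m + 4)) (.var (m + 1)) (m + 5)) <|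
          .ex (m + 5) <| .ex (m + 6) <| .ex (m + 7) <| .ex (m + 8) <|
            .and (.beta (.var (m + 2)) (.var (m + 3)) (.var (m + 4)) (.var (m + 5)) (m + 9)) <|
            .and (.beta (.var (m + 2)) (.var (m + 3)) (.succ (.var (m + 4))) (.var (m + 6))
              (m + 9)) <|
            .and (.isPair (.var (m + 7)) (.var (m + 4)) (.var (m + 5)) (m + 9)) <|
            .and (.isPair (.var (m + 8)) (.var m) (.var (m + 7)) (m + 9)) <|
            g.graph (m + 8) (m + 6) (m + 9)) <|
        .beta (.var (m + 2)) (.var (m + 3)) (.var (m + 1)) (.var o) (m + 4)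

/-- The proof predicate `x_u : x_w`, an arithmetical formula, "`x_u` is the code of a derivation in
Peano Arithmetic of the formula with code `x_w`" (where `u, w < m`). -/
def proofFml (u w m : ℕ) : Fml :=
  .ex m (.ex (m + 1) (.and (.isPair (.var m) (.var u) (.var w) (m + 2))
    (.and (.eq (.var (m + 1)) (.succ .zero)) (PR.proofChar.graph m (m + 1) (m + 2)))))

/-- The arithmetical formula `s(x₀) : f(x₀)`, where `s` and `f` are primitive recursive terms. -/
def proofOf (s f : PR) : Fml :=
  .ex 1 (.ex 2 (.and (s.graph 0 1 3) (.and (f.graph 0 2 3) (proofFml 1 2 3))))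

/-! ### Serial properties and selector proofs -/

/-- A serial property `{F₀, F₁, F₂, …}` of arithmetical sentences, with a primitive recursive term
`name` (`F•` below) such that `F•(n) = ⌜F_n⌝` for all `n`. -/
structure SerialProperty where
  inst : ℕ → Fml
  isSentence : ∀ n, (inst n).IsSentence
  name : PR
  name_eval : ∀ n, name.eval n = (inst n).code

/-- A selector proof of a serial property in Peano Arithmetic: a primitive recursive selector `s`
and a verifier, which is a derivation in Peano Arithmetic of `∀ x [s(x) : F•(x)]`. -/
structure SelectorProof (F : SerialProperty) where
  selector : PR
  verifier : Derivation (.all 0 (proofOf selector F.name))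

/-- The serial property `F` is provable in Peano Arithmetic (by a selector proof). -/
def SerialProperty.SelectorProvable (F : SerialProperty) : Prop := Nonempty (SelectorProof F)

end PeanoArith

namespace PeanoArith

/-! ### The standard model -/

/-! The argument is semantic. Peano Arithmetic is sound for the natural numbers
(`Derivation.sound`), so the sentence derived by a verifier is true: for every `n`, the formula
`s(x₀) : F•(x₀)` holds at `n`. What it says there is that the number `s(n)` passes the primitive
recursive test for being a derivation of `F_n`. An actual derivation of `F_n` is then decoded from
that number. Claim (2) follows from (1) and consistency, which is again soundness: `0 = 1` is false.

The work lies in showing that the arithmetized notions mean what they should. `PR.eval_of_sat_graph`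
passes from truth of the graph formula of a primitive recursive term to the value of the term.
`PR.exists_provable_of_concl` passes from the output of the proof checker to a derivation, by strong
induction on the code, and `Fml.code_injective` identifies the formula derived.

Only one direction is needed throughout. Graph formulas must hold of nothing but the correct values,
so no sequence ever has to be coded by the beta function and no Chinese remainder argument occurs.
Likewise the checker must accept nothing but derivations; that it accepts all of them plays no role.
-/

/-- The value of a term in the standard model under an assignment. -/
def Tm.val (v : ℕ → ℕ) : Tm → ℕ
  | var k => v k
  | zero => 0
  | succ t => t.val v + 1
  | add t u => t.val v + u.val v
  | mul t u => t.val v * u.val v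

/-- Truth of a formula in the standard model under an assignment. -/
def Fml.Sat : (ℕ → ℕ) → Fml → Prop
  | v, eq t u => t.val v = u.val v
  | v, neg φ => ¬ φ.Sat v
  | v, imp φ ψ => φ.Sat v → ψ.Sat v
  | v, all k φ => ∀ a, φ.Sat (Function.update v k a)

/-! ### Coincidence and substitution lemmas for the standard model -/

theorem Tm.val_congr {v w : ℕ → ℕ} (t : Tm) (h : ∀ k ∈ t.vars, v k = w k) :
    t.val v = t.val w := by
  induction t with
  | var k => exact h k (by simp [vars])
  | zero => rfl
  | succ t ih => simp only [val]; rw [ih h]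
  | add t u iht ihu | mul t u iht ihu =>
    simp only [val]
    rw [iht fun k hk => h k (by simp [vars, hk]), ihu fun k hk => h k (by simp [vars, hk])]

theorem Tm.val_update {v : ℕ → ℕ} {k a : ℕ} {t : Tm} (h : k ∉ t.vars) :
    t.val (Function.update v k a) = t.val v :=
  t.val_congr fun j hj => Function.update_of_ne (by rintro rfl; exact h hj) _ _

theorem Tm.val_subst (v : ℕ → ℕ) (k : ℕ) (t u : Tm) :
    (u.subst k t).val v = u.val (Function.update v k (t.val v)) := by
  induction u with
  | var j =>
    by_cases h : j = k
    · subst h; simp [subst, val]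
    · simp [subst, val, h]
  | zero => rfl
  | succ u ih => simp [subst, val, ih]
  | add u w ihu ihw | mul u w ihu ihw => simp [subst, val, ihu, ihw]

namespace Fml

theorem sat_congr (φ : Fml) {v w : ℕ → ℕ} (h : ∀ k ∈ φ.fv, v k = w k) :
    φ.Sat v ↔ φ.Sat w := by
  induction φ generalizing v w with
  | eq t u =>
    simp only [Sat]
    rw [t.val_congr fun k hk => h k (by simp [fv, hk]),
      u.val_congr fun k hk => h k (by simp [fv, hk])]
  | neg φ ih => exact not_congr (ih h)
  | imp φ ψ ihφ ihψ =>
    exact imp_congr (ihφ fun k hk => h k (by simp [fv, hk]))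
      (ihψ fun k hk => h k (by simp [fv, hk]))
  | all j φ ih =>
    refine forall_congr' fun a => ih fun k hk => ?_
    by_cases hkj : k = j
    · subst hkj; simp
    · simpa [hkj] using h k (by simp [fv, hkj, hk])

theorem sat_update {φ : Fml} {v : ℕ → ℕ} {k a : ℕ} (h : k ∉ φ.fv) :
    φ.Sat (Function.update v k a) ↔ φ.Sat v :=
  φ.sat_congr fun _ hj => Function.update_of_ne (by rintro rfl; exact h hj) _ _

/-- Nothing is replaced, so capture cannot matter and `t` need not be free for `x_k`. This covers
the first alternative in the quantifier clause of `FreeFor`, which gives no information about the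
body. -/
theorem subst_of_notMem_fv {φ : Fml} {v : ℕ → ℕ} {k : ℕ} {t : Tm} (h : k ∉ φ.fv) :
    (φ.subst k t).Sat v ↔ φ.Sat v := by
  induction φ generalizing v with
  | eq u w =>
    simp only [fv, Finset.mem_union, not_or] at h
    simp only [subst, Sat, Tm.val_subst, Tm.val_update h.1, Tm.val_update h.2]
  | neg φ ih => exact not_congr (ih h)
  | imp φ ψ ihφ ihψ =>
    simp only [fv, Finset.mem_union, not_or] at h
    exact imp_congr (ihφ h.1) (ihψ h.2)
  | all j φ ih =>
    by_cases hjk : j = k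
    · simp [subst, hjk]
    · have h' : k ∉ φ.fv := fun hk => h (by simp [fv, hk, Ne.symm hjk])
      simp only [subst, hjk, if_false]
      exact forall_congr' fun a => ih h'

theorem sat_subst {φ : Fml} {v : ℕ → ℕ} {k : ℕ} {t : Tm} (h : φ.FreeFor k t) :
    (φ.subst k t).Sat v ↔ φ.Sat (Function.update v k (t.val v)) := by
  induction φ generalizing v with
  | eq u w => simp only [subst, Sat, Tm.val_subst]
  | neg φ ih => exact not_congr (ih h)
  | imp φ ψ ihφ ihψ => exact imp_congr (ihφ h.1) (ihψ h.2)
  | all j φ ih =>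
    rcases h with h | ⟨hj, h⟩
    · rw [subst_of_notMem_fv h, sat_update h]
    · by_cases hjk : j = k
      · subst hjk
        simp [subst, Sat]
      · simp only [subst, hjk, if_false]
        refine forall_congr' fun a => ?_
        rw [ih h, Tm.val_update hj, Function.update_comm (Ne.symm hjk)]

/-- The only variable that a quantifier could capture is `x_k` itself, and `x_k` is not free in a
formula beginning with `∀ x_k`. Together with `freeFor_zero` this makes the induction schema sound,
although it carries no side condition on substitution. -/
theorem freeFor_succ_var (k : ℕ) (φ : Fml) : φ.FreeFor k (.succ (.var k)) := by
  induction φ with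
  | eq => trivial
  | neg φ ih => exact ih
  | imp φ ψ ihφ ihψ => exact ⟨ihφ, ihψ⟩
  | all j φ ih =>
    by_cases hjk : j = k
    · exact .inl (by simp [fv, hjk])
    · exact .inr ⟨by simp [Tm.vars, hjk], ih⟩

theorem freeFor_zero (k : ℕ) (φ : Fml) : φ.FreeFor k .zero := by
  induction φ with
  | eq => trivial
  | neg φ ih => exact ih
  | imp φ ψ ihφ ihψ => exact ⟨ihφ, ihψ⟩
  | all j φ ih => exact .inr ⟨by simp [Tm.vars], ih⟩

end Fml

/-- Soundness: the theorems of Peano Arithmetic are true in the standard model. -/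
theorem Derivation.sound {φ : Fml} (d : Derivation φ) (v : ℕ → ℕ) : φ.Sat v := by
  induction d generalizing v with
  | ax1 φ ψ => exact fun h _ => h
  | ax2 φ ψ χ => exact fun h g x => h x (g x)
  | ax3 φ ψ => exact fun h x => by_contra fun y => h y x
  | inst k t φ h => exact fun hall => (Fml.sat_subst h).2 (hall _)
  | dist k φ ψ h => exact fun hall hφ a => hall a ((Fml.sat_update h).2 hφ)
  | refl t => exact rfl
  | leibniz k t u φ ht hu =>
    intro h hφ
    rw [Fml.sat_subst hu]
    rw [Fml.sat_subst ht] at hφ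
    rwa [← show t.val v = u.val v from h]
  | succ_ne_zero => simp [Fml.Sat, Tm.val]
  | succ_inj => simp [Fml.Sat, Tm.val]
  | add_zero => simp [Fml.Sat, Tm.val]
  | add_succ => simp [Fml.Sat, Tm.val, Nat.add_assoc]
  | mul_zero => simp [Fml.Sat, Tm.val]
  | mul_succ => simp [Fml.Sat, Tm.val, Nat.mul_succ]
  | induction k φ =>
    intro h0 hs a
    induction a with
    | zero => exact (Fml.sat_subst (Fml.freeFor_zero k φ)).1 h0
    | succ a ih =>
      simpa [Tm.val] using (Fml.sat_subst (Fml.freeFor_succ_var k φ)).1 (hs a ih)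
  | mp d e ihd ihe => exact ihd v (ihe v)
  | gen k d ih => exact fun a => ih _

/-! ### Truth of the formulas for order, pairing, beta function and graphs -/

namespace Fml

@[simp] theorem sat_eq {v : ℕ → ℕ} {t u : Tm} : (eq t u).Sat v ↔ t.val v = u.val v := Iff.rfl

@[simp] theorem sat_imp {v : ℕ → ℕ} {φ ψ : Fml} :
    (imp φ ψ).Sat v ↔ (φ.Sat v → ψ.Sat v) := Iff.rfl

@[simp] theorem sat_all {v : ℕ → ℕ} {k : ℕ} {φ : Fml} :
    (all k φ).Sat v ↔ ∀ a, φ.Sat (Function.update v k a) := Iff.rfl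

@[simp] theorem sat_and {v : ℕ → ℕ} {φ ψ : Fml} : (and φ ψ).Sat v ↔ φ.Sat v ∧ ψ.Sat v := by
  simp [and, Sat]

@[simp] theorem sat_or {v : ℕ → ℕ} {φ ψ : Fml} : (or φ ψ).Sat v ↔ φ.Sat v ∨ ψ.Sat v := by
  simp only [or, Sat]; tauto

@[simp] theorem sat_ex {v : ℕ → ℕ} {k : ℕ} {φ : Fml} :
    (ex k φ).Sat v ↔ ∃ a, φ.Sat (Function.update v k a) := by
  simp [ex, Sat]

theorem sat_lt {v : ℕ → ℕ} {t u : Tm} {w : ℕ} (ht : w ∉ t.vars) (hu : w ∉ u.vars) :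
    (lt t u w).Sat v ↔ t.val v < u.val v := by
  simp only [lt, sat_ex, sat_eq, Tm.val, Tm.val_update ht, Tm.val_update hu,
    Function.update_self]
  exact ⟨fun ⟨a, h⟩ => by omega, fun h => ⟨u.val v - t.val v - 1, by omega⟩⟩

theorem sat_le {v : ℕ → ℕ} {t u : Tm} {w : ℕ} (ht : w ∉ t.vars) (hu : w ∉ u.vars) :
    (le t u w).Sat v ↔ t.val v ≤ u.val v := by
  simp only [le, sat_ex, sat_eq, Tm.val, Tm.val_update ht, Tm.val_update hu,
    Function.update_self]
  exact ⟨fun ⟨a, h⟩ => by omega, fun h => ⟨u.val v - t.val v, by omega⟩⟩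

/-- The two disjuncts are the two branches in the definition of `Nat.pair`. The variable `x_w` is
quantified only in the comparisons of `t` and `u`, so it may occur in `z`. -/
theorem sat_isPair {v : ℕ → ℕ} {z t u : Tm} {w : ℕ} (ht : w ∉ t.vars) (hu : w ∉ u.vars) :
    (isPair z t u w).Sat v ↔ z.val v = Nat.pair (t.val v) (u.val v) := by
  simp only [isPair, sat_or, sat_and, sat_lt ht hu, sat_le hu ht, sat_eq, Tm.val, Nat.pair]
  split_ifs <;> omega

/-- Uniqueness of division with remainder: the second conjunct of `beta` asserts a quotient, the
first bounds the remainder by the modulus. -/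
theorem sat_beta {v : ℕ → ℕ} {c d j r : Tm} {w : ℕ} (hc : w ∉ c.vars) (hd : w ∉ d.vars)
    (hj : w ∉ j.vars) (hr : w ∉ r.vars) :
    (beta c d j r w).Sat v ↔ r.val v = c.val v % ((j.val v + 1) * d.val v + 1) := by
  rw [beta, sat_and, sat_lt hr (by simp [Tm.vars, hd, hj])]
  simp only [sat_ex, sat_eq, Tm.val, Tm.val_update hc, Tm.val_update hd, Tm.val_update hj,
    Tm.val_update hr, Function.update_self]
  constructor
  · rintro ⟨hlt, q, hq⟩
    rw [hq, Nat.mul_comm q, Nat.mul_add_mod, Nat.mod_eq_of_lt hlt]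
  · intro h
    rw [h]
    exact ⟨Nat.mod_lt _ (Nat.succ_pos _), _, (Nat.div_add_mod' _ _).symm⟩

end Fml

/-- In the standard model, `c(x_i) = x_o` holds only of the values of `c`. -/
theorem PR.eval_of_sat_graph (c : PR) {i o m : ℕ} {v : ℕ → ℕ} (hi : i < m) (ho : o < m)
    (h : (c.graph i o m).Sat v) : v o = c.eval (v i) := by
  induction c generalizing i o m v with
  | zero => simpa [graph, Tm.val, eval] using h
  | succ => simpa [graph, Tm.val, eval] using h
  | left =>
    simp only [graph, Fml.sat_ex] at h
    obtain ⟨a, h⟩ := h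
    rw [Fml.sat_isPair (by simp [Tm.vars]; omega) (by simp [Tm.vars])] at h
    simp (discharger := omega) only [Tm.val, Function.update_self, Function.update_of_ne] at h
    simp [eval, h]
  | right =>
    simp only [graph, Fml.sat_ex] at h
    obtain ⟨a, h⟩ := h
    rw [Fml.sat_isPair (by simp [Tm.vars]) (by simp [Tm.vars]; omega)] at h
    simp (discharger := omega) only [Tm.val, Function.update_self, Function.update_of_ne] at h
    simp [eval, h]
  | pair f g ihf ihg =>
    simp only [graph, Fml.sat_ex, Fml.sat_and] at h
    obtain ⟨a, b, hf, hg, h⟩ := h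
    rw [Fml.sat_isPair (by simp [Tm.vars]) (by simp [Tm.vars])] at h
    replace hf := ihf (by omega) (by omega) hf
    replace hg := ihg (by omega) (by omega) hg
    simp (discharger := omega) only [Tm.val, Function.update_self, Function.update_of_ne]
      at h hf hg
    rw [h, hf, hg, eval]
  | comp f g ihf ihg =>
    simp only [graph, Fml.sat_ex, Fml.sat_and] at h
    obtain ⟨a, hg, hf⟩ := h
    replace hf := ihf (by omega) (by omega) hf
    replace hg := ihg (by omega) (by omega) hg
    simp (discharger := omega) only [Function.update_self, Function.update_of_ne] at hf hg
    rw [hf, hg, eval]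
  | prec f g ihf ihg =>
    simp only [graph, Fml.sat_ex, Fml.sat_and, Fml.sat_all, Fml.sat_imp] at h
    obtain ⟨a, n, c, d, hp, ⟨r, hr, hf⟩, hs, hb⟩ := h
    rw [Fml.sat_isPair (by simp [Tm.vars]) (by simp [Tm.vars])] at hp
    rw [Fml.sat_beta (by simp [Tm.vars]) (by simp [Tm.vars]) (by simp [Tm.vars])
      (by simp [Tm.vars])] at hr
    rw [Fml.sat_beta (by simp [Tm.vars]) (by simp [Tm.vars]) (by simp [Tm.vars])
      (by simp [Tm.vars]; omega)] at hb
    replace hf := ihf (by omega) (by omega) hf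
    simp (discharger := omega) only [Tm.val, Function.update_self, Function.update_of_ne]
      at hp hr hb hf
    -- The sequence coded by `c` and `d` is given; its entries up to index `n` are forced, one after
    -- another, by the initial clause and the step clause.
    suffices H : ∀ j ≤ n, c % ((j + 1) * d + 1) = (prec f g).eval (Nat.pair a j) by
      rw [hb, hp, H n le_rfl]
    intro j hj
    induction j with
    | zero => rw [← hr, hf]; simp [eval]
    | succ j ih =>
      have hs := hs j
      rw [Fml.sat_lt (by simp [Tm.vars]) (by simp [Tm.vars])] at hs
      simp (discharger := omega) only [Tm.val, Function.update_self, Function.update_of_ne]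
        at hs
      -- `x` and `y` are the entries at `j` and `j + 1`, `z = ⟨j, x⟩`, and `w = ⟨a, z⟩` is the
      -- argument handed to `g`.
      obtain ⟨x, y, z, w, hx, hy, hz, hw, hg⟩ := hs (by omega)
      rw [Fml.sat_beta (by simp [Tm.vars]) (by simp [Tm.vars]) (by simp [Tm.vars])
        (by simp [Tm.vars])] at hx hy
      rw [Fml.sat_isPair (by simp [Tm.vars]) (by simp [Tm.vars])] at hz hw
      replace hg := ihg (by omega) (by omega) hg
      simp (discharger := omega) only [Tm.val, Function.update_self, Function.update_of_ne]
        at hx hy hz hw hg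
      rw [← hy, hg, hw, hz, hx, ih (by omega)]
      simp [eval]

/-- In the standard model, `s(x₀) : f(x₀)` says that the proof predicate holds of the values. -/
theorem proofChar_eval_of_sat_proofOf {s f : PR} {v : ℕ → ℕ} (h : (proofOf s f).Sat v) :
    PR.proofChar.eval (Nat.pair (s.eval (v 0)) (f.eval (v 0))) = 1 := by
  simp only [proofOf, proofFml, Fml.sat_ex, Fml.sat_and] at h
  obtain ⟨p, y, hp, hy, z, e, hz, he, hc⟩ := h
  replace hp := s.eval_of_sat_graph (by omega) (by omega) hp
  replace hy := f.eval_of_sat_graph (by omega) (by omega) hy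
  replace hc := PR.proofChar.eval_of_sat_graph (by omega) (by omega) hc
  rw [Fml.sat_isPair (by simp [Tm.vars]) (by simp [Tm.vars])] at hz
  simp (discharger := omega) only [Fml.sat_eq, Tm.val, Function.update_self, Function.update_of_ne]
    at hp hy hz he hc
  rw [← hp, ← hy, ← hz, ← hc, he]

/-! ### Unique readability of codes -/

theorem Tm.code_injective : Function.Injective Tm.code := by
  intro t
  induction t with
  | var k => intro u h; cases u <;> simp_all [code]
  | zero => intro u h; cases u <;> simp_all [code]
  | succ t ih =>
    intro u h
    cases u <;> simp [code] at h
    rw [ih h]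
  | add t₁ t₂ ih₁ ih₂ | mul t₁ t₂ ih₁ ih₂ =>
    intro u h
    cases u <;> simp [code] at h
    rw [ih₁ h.1, ih₂ h.2]

/-- Used twice: in modus ponens, to match the antecedent with the minor premise, and at the end, to
identify the decoded theorem with the given formula. -/
theorem Fml.code_injective : Function.Injective Fml.code := by
  intro φ
  induction φ with
  | eq t u =>
    intro ψ h
    cases ψ <;> simp [code] at h
    rw [Tm.code_injective h.1, Tm.code_injective h.2]
  | neg φ ih =>
    intro ψ h
    cases ψ <;> simp [code] at h
    rw [ih h]
  | imp φ₁ φ₂ ih₁ ih₂ =>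
    intro ψ h
    cases ψ <;> simp [code] at h
    rw [ih₁ h.1, ih₂ h.2]
  | all k φ ih =>
    intro ψ h
    cases ψ <;> simp [code] at h
    rw [h.1, ih h.2]

namespace PR

/-! ### Values of the combinators -/

section Combinators

variable (f g c h e t p G : PR) (a n : ℕ)

@[simp] theorem eval_zero : zero.eval n = 0 := rfl
@[simp] theorem eval_succ : succ.eval n = n + 1 := rfl
@[simp] theorem eval_left : left.eval n = n.unpair.1 := rfl
@[simp] theorem eval_right : right.eval n = n.unpair.2 := rfl
@[simp] theorem eval_pair : (pair f g).eval n = Nat.pair (f.eval n) (g.eval n) := rfl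
@[simp] theorem eval_comp : (comp f g).eval n = f.eval (g.eval n) := rfl

@[simp] theorem eval_id : id.eval n = n := by simp [id]

@[simp] theorem eval_num (j : ℕ) : (num j).eval n = j := by
  induction j with
  | zero => rfl
  | succ j ih => simp [num, ih]

@[simp] theorem eval_pred : (pred f).eval n = f.eval n - 1 := by
  simp only [pred, eval, Nat.unpair_pair]
  cases f.eval n <;> simp

@[simp] theorem eval_add : (add f g).eval n = f.eval n + g.eval n := by
  simp only [add, eval_comp, eval_pair]
  induction g.eval n with
  | zero => simp [eval]
  | succ b ih => simpa [eval, ← Nat.add_assoc] using ih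

@[simp] theorem eval_sub : (sub f g).eval n = f.eval n - g.eval n := by
  simp only [sub, eval_comp, eval_pair]
  induction g.eval n with
  | zero => simp [eval]
  | succ b ih => simp [eval] at ih ⊢; omega

@[simp] theorem eval_eqv : (eqv f g).eval n = if f.eval n = g.eval n then 1 else 0 := by
  simp only [eqv, eval_sub, eval_num, eval_add]
  split_ifs <;> omega

@[simp] theorem eval_ite :
    (ite c g h).eval n = if c.eval n = 0 then h.eval n else g.eval n := by
  simp only [ite, eval_comp, eval_pair, eval_id]
  cases c.eval n <;> simp [eval]

/-- Any nonzero number counts as true: `conj` may return the value of its second argument, and the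
proof checker uses codes of conclusions as truth values. The tests are therefore characterized by
nonvanishing, not by the value `1`. -/
theorem eval_conj_ne_zero :
    (conj f g).eval n ≠ 0 ↔ f.eval n ≠ 0 ∧ g.eval n ≠ 0 := by
  by_cases hf : f.eval n = 0 <;> simp [conj, hf]

theorem eval_disj_ne_zero :
    (disj f g).eval n ≠ 0 ↔ f.eval n ≠ 0 ∨ g.eval n ≠ 0 := by
  by_cases hf : f.eval n = 0 <;> simp [disj, hf]

theorem eval_neg_ne_zero : (neg f).eval n ≠ 0 ↔ ¬ f.eval n ≠ 0 := by
  simp [neg]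

theorem eval_eqv_ne_zero : (eqv f g).eval n ≠ 0 ↔ f.eval n = g.eval n := by
  simp

/-- The offset `i` is general because it grows along the list in the induction; only `i = 0` is used
later. -/
theorem eval_switch (i : ℕ) (cs : List PR) : (switch t i cs).eval n =
    if i ≤ t.eval n then (cs.getD (t.eval n - i) zero).eval n else 0 := by
  induction cs generalizing i with
  | nil => simp [switch]
  | cons c cs ih =>
    simp only [switch, eval_ite, eval_eqv, eval_num, ih]
    rcases lt_trichotomy i (t.eval n) with hlt | heq | hgt
    · rw [show t.eval n - i = t.eval n - (i + 1) + 1 by omega]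
      simp [hlt.ne', hlt.le, Nat.succ_le_of_lt hlt]
    · simp [← heq]
    · simp [hgt.ne, hgt, Nat.not_le.2 (Nat.lt_succ_of_lt hgt)]

theorem eval_switch_zero (cs : List PR) :
    (switch t 0 cs).eval n = (cs.getD (t.eval n) zero).eval n := by
  simp [eval_switch]

theorem eval_guard_eq_succ (j : ℕ) :
    (guard c p).eval n = j + 1 ↔ c.eval n ≠ 0 ∧ p.eval n = j := by
  by_cases hc : c.eval n = 0 <;> simp [guard, hc]

/-- The table `⟨h (n-1), … ⟨h 0, 0⟩ … ⟩` of a course-of-values recursion. -/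
def covTable : ℕ → ℕ
  | 0 => 0
  | n + 1 => Nat.pair (G.eval (Nat.pair a (Nat.pair n (covTable n)))) (covTable n)

/-- The argument of the step of a course-of-values recursion. -/
def covArg : ℕ := Nat.pair a (Nat.pair n (covTable G a n))

/-- The inner primitive recursion builds the table, as `key` verifies. `cov` runs it for one step
more than `n` and takes the head, which is the newest value. -/
theorem eval_cov : (cov G).eval (Nat.pair a n) = G.eval (covArg G a n) := by
  have key (j : ℕ) : (prec zero (pair G (comp right right))).eval (Nat.pair a j) =
      covTable G a j := by
    induction j with
    | zero => simp [eval, covTable]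
    | succ j ih => simp [eval, covTable] at ih ⊢; simp [ih]
  simp [cov, key, covTable, covArg]

@[simp] theorem eval_prm : prm.eval (covArg G a n) = a := by simp [prm, covArg]
@[simp] theorem eval_arg : arg.eval (covArg G a n) = n := by simp [arg, covArg]
@[simp] theorem eval_tag : tag.eval (covArg G a n) = n.unpair.1 := by simp [tag]
@[simp] theorem eval_body : body.eval (covArg G a n) = n.unpair.2 := by simp [body]
@[simp] theorem eval_body1 : body1.eval (covArg G a n) = n.unpair.2.unpair.1 := by simp [body1]
@[simp] theorem eval_body2 : body2.eval (covArg G a n) = n.unpair.2.unpair.2 := by simp [body2]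

/-- The table in use at stage `n` starts with the value at `n - 1`, so the value at `i` is the head
after `n - 1 - i` tails. The bound `i < n` keeps the truncated subtraction exact. -/
theorem eval_prev (he : e.eval (covArg G a n) < n) :
    (prev e).eval (covArg G a n) = (cov G).eval (Nat.pair a (e.eval (covArg G a n))) := by
  have drop (j i : ℕ) (T : ℕ) (hT : T = covTable G a (j + i)) :
      (prec id (comp right (comp right right))).eval (Nat.pair T i) = covTable G a j := by
    induction i generalizing j with
    | zero => simpa [eval] using hT
    | succ i ih =>
      have := ih (j + 1) (by rw [hT]; congr 1; omega)
      simp [eval] at this ⊢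
      simp [this, covTable]
  generalize hi : e.eval (covArg G a n) = i at he ⊢
  have hd := drop (i + 1) (n - 1 - i) _
    (show covTable G a n = covTable G a (i + 1 + (n - 1 - i)) by congr 1; omega)
  simp only [prev, eval_comp, eval_pair, eval_sub, eval_pred, eval_arg, hi]
  rw [show (covArg G a n |> right.eval |> right.eval) = covTable G a n by simp [covArg]] at *
  rw [hd, eval_cov]
  simp [covTable, covArg]

end Combinators

/-- Ensures that recursive calls on parts of a body stay inside the table. It fails for tag `0`, for
example `Nat.pair 0 1 = 1`; accordingly no clause for tag `0` makes a recursive call. -/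
theorem lt_pair_succ (t b : ℕ) : b < Nat.pair (t + 1) b :=
  lt_of_lt_of_le (Nat.lt_succ_self b) <| by
    unfold Nat.pair
    split_ifs <;> nlinarith

section Steps

variable {G : PR} {a t b : ℕ}

/-- The step enters as a variable `G` with an equation, so that its long list of clauses does not
reappear inside `covArg`. -/
theorem eval_cov_switch {cs : List PR} (hG : G = switch tag 0 cs) :
    (cov G).eval (Nat.pair a (Nat.pair t b)) =
      (cs.getD t zero).eval (covArg G a (Nat.pair t b)) := by
  rw [eval_cov]
  -- Unfolding also affects the copy of `G` inside `covArg`; rewriting back restores it.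
  conv_lhs => rw [hG, eval_switch_zero, ← hG, eval_tag, Nat.unpair_pair]

theorem eval_prev_of_le {e : PR} (ht : t ≠ 0) (he : e.eval (covArg G a (Nat.pair t b)) ≤ b) :
    (prev e).eval (covArg G a (Nat.pair t b)) =
      (cov G).eval (Nat.pair a (e.eval (covArg G a (Nat.pair t b)))) := by
  obtain ⟨t, rfl⟩ := Nat.exists_eq_succ_of_ne_zero ht
  exact eval_prev _ _ _ _ (he.trans_lt (lt_pair_succ t b))

theorem eval_prev_body (ht : t ≠ 0) :
    (prev body).eval (covArg G a (Nat.pair t b)) = (cov G).eval (Nat.pair a b) := by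
  rw [eval_prev_of_le ht (by simp)]; simp

theorem eval_prev_body1 (ht : t ≠ 0) :
    (prev body1).eval (covArg G a (Nat.pair t b)) = (cov G).eval (Nat.pair a b.unpair.1) := by
  rw [eval_prev_of_le ht (by simpa using Nat.unpair_left_le b)]; simp

theorem eval_prev_body2 (ht : t ≠ 0) :
    (prev body2).eval (covArg G a (Nat.pair t b)) = (cov G).eval (Nat.pair a b.unpair.2) := by
  rw [eval_prev_of_le ht (by simpa using Nat.unpair_right_le b)]; simp

end Steps

/-! ### The syntactic operations on codes -/

section Codes

variable {f k u p x : PR} {n : ℕ}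

/-- The step of the recursion in `isTm`. -/
def isTmStep : PR :=
  switch tag 0
    [num 1,
     eqv body zero,
     prev body,
     conj (prev body1) (prev body2),
     conj (prev body1) (prev body2)]

/-- The input is an arbitrary number, so the term is reconstructed by strong induction on the code.
-/
theorem exists_of_isTm (h : (isTm f).eval n ≠ 0) : ∃ t : Tm, f.eval n = t.code := by
  replace h : (cov isTmStep).eval (Nat.pair 0 (f.eval n)) ≠ 0 := h
  generalize f.eval n = c at h
  induction c using Nat.strong_induction_on with
  | _ c ih =>
    obtain ⟨t, b, rfl⟩ : ∃ t b, c = Nat.pair t b := ⟨_, _, (Nat.pair_unpair c).symm⟩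
    rw [eval_cov_switch (G := isTmStep) rfl] at h
    have hle {i} (ht : t ≠ 0) (hi : i ≤ b) : i < Nat.pair t b := by
      obtain ⟨t, rfl⟩ := Nat.exists_eq_succ_of_ne_zero ht
      exact hi.trans_lt (lt_pair_succ t b)
    rcases Nat.lt_or_ge t 5 with ht | ht
    swap
    -- A tag beyond the list selects the default `zero`, against `h`.
    · obtain ⟨t, rfl⟩ := Nat.exists_eq_add_of_le' ht
      exact absurd rfl h
    interval_cases t
    · exact ⟨.var b, rfl⟩
    · replace h : (eqv body zero).eval _ ≠ 0 := h
      rw [eval_eqv_ne_zero] at h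
      simp at h
      exact ⟨.zero, by rw [h, Tm.code]⟩
    · replace h : (prev body).eval _ ≠ 0 := h
      rw [eval_prev_body (by decide)] at h
      obtain ⟨t, ht⟩ := ih _ (hle (by decide) le_rfl) h
      exact ⟨.succ t, by rw [Tm.code, ← ht]⟩
    · replace h : (conj (prev body1) (prev body2)).eval _ ≠ 0 := h
      rw [eval_conj_ne_zero, eval_prev_body1 (by decide), eval_prev_body2 (by decide)] at h
      obtain ⟨t, ht⟩ := ih _ (hle (by decide) (Nat.unpair_left_le b)) h.1
      obtain ⟨u, hu⟩ := ih _ (hle (by decide) (Nat.unpair_right_le b)) h.2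
      exact ⟨.add t u, by rw [Tm.code, ← ht, ← hu, Nat.pair_unpair]⟩
    · replace h : (conj (prev body1) (prev body2)).eval _ ≠ 0 := h
      rw [eval_conj_ne_zero, eval_prev_body1 (by decide), eval_prev_body2 (by decide)] at h
      obtain ⟨t, ht⟩ := ih _ (hle (by decide) (Nat.unpair_left_le b)) h.1
      obtain ⟨u, hu⟩ := ih _ (hle (by decide) (Nat.unpair_right_le b)) h.2
      exact ⟨.mul t u, by rw [Tm.code, ← ht, ← hu, Nat.pair_unpair]⟩

/-- The step of the recursion in `isFml`. -/
def isFmlStep : PR :=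
  switch tag 0
    [conj (isTm body1) (isTm body2),
     prev body,
     conj (prev body1) (prev body2),
     prev body2]

theorem exists_of_isFml (h : (isFml f).eval n ≠ 0) : ∃ φ : Fml, f.eval n = φ.code := by
  replace h : (cov isFmlStep).eval (Nat.pair 0 (f.eval n)) ≠ 0 := h
  generalize f.eval n = c at h
  induction c using Nat.strong_induction_on with
  | _ c ih =>
    obtain ⟨t, b, rfl⟩ : ∃ t b, c = Nat.pair t b := ⟨_, _, (Nat.pair_unpair c).symm⟩
    rw [eval_cov_switch (G := isFmlStep) rfl] at h
    have hle {i} (ht : t ≠ 0) (hi : i ≤ b) : i < Nat.pair t b := by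
      obtain ⟨t, rfl⟩ := Nat.exists_eq_succ_of_ne_zero ht
      exact hi.trans_lt (lt_pair_succ t b)
    rcases Nat.lt_or_ge t 4 with ht | ht
    swap
    · obtain ⟨t, rfl⟩ := Nat.exists_eq_add_of_le' ht
      exact absurd rfl h
    interval_cases t
    · replace h : (conj (isTm body1) (isTm body2)).eval _ ≠ 0 := h
      rw [eval_conj_ne_zero] at h
      obtain ⟨t, ht⟩ := exists_of_isTm h.1
      obtain ⟨u, hu⟩ := exists_of_isTm h.2
      rw [eval_body1, Nat.unpair_pair] at ht
      rw [eval_body2, Nat.unpair_pair] at hu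
      exact ⟨.eq t u, by rw [Fml.code, ← ht, ← hu, Nat.pair_unpair]⟩
    · replace h : (prev body).eval _ ≠ 0 := h
      rw [eval_prev_body (by decide)] at h
      obtain ⟨φ, hφ⟩ := ih _ (hle (by decide) le_rfl) h
      exact ⟨.neg φ, by rw [Fml.code, ← hφ]⟩
    · replace h : (conj (prev body1) (prev body2)).eval _ ≠ 0 := h
      rw [eval_conj_ne_zero, eval_prev_body1 (by decide), eval_prev_body2 (by decide)] at h
      obtain ⟨φ, hφ⟩ := ih _ (hle (by decide) (Nat.unpair_left_le b)) h.1
      obtain ⟨ψ, hψ⟩ := ih _ (hle (by decide) (Nat.unpair_right_le b)) h.2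
      exact ⟨.imp φ ψ, by rw [Fml.code, ← hφ, ← hψ, Nat.pair_unpair]⟩
    · replace h : (prev body2).eval _ ≠ 0 := h
      rw [eval_prev_body2 (by decide)] at h
      obtain ⟨φ, hφ⟩ := ih _ (hle (by decide) (Nat.unpair_right_le b)) h
      exact ⟨.all b.unpair.1 φ, by rw [Fml.code, ← hφ, Nat.pair_unpair]⟩

/-- The step of the recursion in `occTm`. -/
def occTmStep : PR :=
  switch tag 0
    [eqv body prm,
     zero,
     prev body,
     disj (prev body1) (prev body2),
     disj (prev body1) (prev body2)]

/-- Side conditions use this test negated, so occurrence must imply a nonzero value; the implication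
proved for `isTm` would be the wrong one. Since the input is known to be a code, the induction runs
over the term itself. -/
theorem eval_occTm_ne_zero {t : Tm} (ht : u.eval n = t.code) :
    (occTm k u).eval n ≠ 0 ↔ k.eval n ∈ t.vars := by
  change (cov occTmStep).eval (Nat.pair (k.eval n) (u.eval n)) ≠ 0 ↔ _
  rw [ht]
  generalize k.eval n = j
  clear ht
  induction t with
  | var i =>
    rw [Tm.code, eval_cov_switch (G := occTmStep) rfl]
    change (eqv body prm).eval _ ≠ 0 ↔ _
    rw [eval_eqv_ne_zero]
    simp [Tm.vars, eq_comm]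
  | zero =>
    rw [Tm.code, eval_cov_switch (G := occTmStep) rfl]
    exact iff_of_false (by simp) (by simp [Tm.vars])
  | succ t ih =>
    rw [Tm.code, eval_cov_switch (G := occTmStep) rfl]
    change (prev body).eval _ ≠ 0 ↔ _
    rw [eval_prev_body (by decide), ih, Tm.vars]
  | add t u iht ihu | mul t u iht ihu =>
    rw [Tm.code, eval_cov_switch (G := occTmStep) rfl]
    change (disj (prev body1) (prev body2)).eval _ ≠ 0 ↔ _
    rw [eval_disj_ne_zero, eval_prev_body1 (by decide), eval_prev_body2 (by decide),
      Nat.unpair_pair, iht, ihu, Tm.vars, Finset.mem_union]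

/-- The step of the recursion in `occFml`. -/
def occFmlStep : PR :=
  switch tag 0
    [disj (occTm prm body1) (occTm prm body2),
     prev body,
     disj (prev body1) (prev body2),
     conj (neg (eqv body1 prm)) (prev body2)]

theorem eval_occFml_ne_zero {φ : Fml} (hφ : p.eval n = φ.code) :
    (occFml k p).eval n ≠ 0 ↔ k.eval n ∈ φ.fv := by
  change (cov occFmlStep).eval (Nat.pair (k.eval n) (p.eval n)) ≠ 0 ↔ _
  rw [hφ]
  generalize k.eval n = j
  clear hφ
  induction φ with
  | eq t u =>
    rw [Fml.code, eval_cov_switch (G := occFmlStep) rfl]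
    change (disj (occTm prm body1) (occTm prm body2)).eval _ ≠ 0 ↔ _
    rw [eval_disj_ne_zero, eval_occTm_ne_zero (t := t) (by simp),
      eval_occTm_ne_zero (t := u) (by simp), eval_prm, Fml.fv, Finset.mem_union]
  | neg φ ih =>
    rw [Fml.code, eval_cov_switch (G := occFmlStep) rfl]
    change (prev body).eval _ ≠ 0 ↔ _
    rw [eval_prev_body (by decide), ih, Fml.fv]
  | imp φ ψ ihφ ihψ =>
    rw [Fml.code, eval_cov_switch (G := occFmlStep) rfl]
    change (disj (prev body1) (prev body2)).eval _ ≠ 0 ↔ _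
    rw [eval_disj_ne_zero, eval_prev_body1 (by decide), eval_prev_body2 (by decide),
      Nat.unpair_pair, ihφ, ihψ, Fml.fv, Finset.mem_union]
  | all i φ ih =>
    rw [Fml.code, eval_cov_switch (G := occFmlStep) rfl]
    change (conj (neg (eqv body1 prm)) (prev body2)).eval _ ≠ 0 ↔ _
    rw [eval_conj_ne_zero, eval_neg_ne_zero, eval_eqv_ne_zero, eval_prev_body2 (by decide)]
    simp only [eval_body1, eval_prm, Nat.unpair_pair, ih, Fml.fv, Finset.mem_erase, ne_eq,
      eq_comm]

/-- The step of the recursion in `substTm`. -/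
def substTmStep : PR :=
  switch tag 0
    [ite (eqv body (comp left prm)) (comp right prm) (mkVar body),
     mkZero,
     mkSucc (prev body),
     mkAdd (prev body1) (prev body2),
     mkMul (prev body1) (prev body2)]

theorem eval_substTm {t s : Tm} (ht : u.eval n = t.code) (hs : x.eval n = s.code) :
    (substTm k u x).eval n = (s.subst (k.eval n) t).code := by
  change (cov substTmStep).eval (Nat.pair (Nat.pair (k.eval n) (u.eval n)) (x.eval n)) = _
  rw [ht, hs]
  generalize k.eval n = j
  clear ht hs
  induction s with
  | var i =>
    rw [Tm.code, eval_cov_switch (G := substTmStep) rfl]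
    change (ite (eqv body (comp left prm)) (comp right prm) (mkVar body)).eval _ = _
    by_cases hij : i = j <;> simp [hij, mkVar, Tm.subst, Tm.code]
  | zero =>
    rw [Tm.code, eval_cov_switch (G := substTmStep) rfl]
    change mkZero.eval _ = _
    simp [mkZero, Tm.subst, Tm.code]
  | succ s ih =>
    rw [Tm.code, eval_cov_switch (G := substTmStep) rfl]
    change (mkSucc (prev body)).eval _ = _
    rw [mkSucc, eval_pair, eval_num, eval_prev_body (by decide), ih, Tm.subst, Tm.code]
  | add s₁ s₂ ih₁ ih₂ =>
    rw [Tm.code, eval_cov_switch (G := substTmStep) rfl]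
    change (mkAdd (prev body1) (prev body2)).eval _ = _
    rw [mkAdd, eval_pair, eval_pair, eval_num, eval_prev_body1 (by decide),
      eval_prev_body2 (by decide), Nat.unpair_pair, ih₁, ih₂, Tm.subst, Tm.code]
  | mul s₁ s₂ ih₁ ih₂ =>
    rw [Tm.code, eval_cov_switch (G := substTmStep) rfl]
    change (mkMul (prev body1) (prev body2)).eval _ = _
    rw [mkMul, eval_pair, eval_pair, eval_num, eval_prev_body1 (by decide),
      eval_prev_body2 (by decide), Nat.unpair_pair, ih₁, ih₂, Tm.subst, Tm.code]

/-- The step of the recursion in `substFml`. -/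
def substFmlStep : PR :=
  switch tag 0
    [mkEq (substTm (comp left prm) (comp right prm) body1)
       (substTm (comp left prm) (comp right prm) body2),
     mkNeg (prev body),
     mkImp (prev body1) (prev body2),
     ite (eqv body1 (comp left prm)) arg (mkAll body1 (prev body2))]

theorem eval_substFml {t : Tm} {φ : Fml} (ht : u.eval n = t.code) (hφ : p.eval n = φ.code) :
    (substFml k u p).eval n = (φ.subst (k.eval n) t).code := by
  change (cov substFmlStep).eval (Nat.pair (Nat.pair (k.eval n) (u.eval n)) (p.eval n)) = _
  rw [ht, hφ]
  generalize k.eval n = j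
  clear ht hφ
  induction φ with
  | eq s₁ s₂ =>
    rw [Fml.code, eval_cov_switch (G := substFmlStep) rfl]
    change (mkEq (substTm (comp left prm) (comp right prm) body1)
      (substTm (comp left prm) (comp right prm) body2)).eval _ = _
    rw [mkEq, eval_pair, eval_pair, eval_num, eval_substTm (t := t) (s := s₁) (by simp) (by simp),
      eval_substTm (t := t) (s := s₂) (by simp) (by simp), eval_comp, eval_prm, eval_left,
      Nat.unpair_pair, Fml.subst, Fml.code]
  | neg φ ih =>
    rw [Fml.code, eval_cov_switch (G := substFmlStep) rfl]
    change (mkNeg (prev body)).eval _ = _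
    rw [mkNeg, eval_pair, eval_num, eval_prev_body (by decide), ih, Fml.subst, Fml.code]
  | imp φ ψ ihφ ihψ =>
    rw [Fml.code, eval_cov_switch (G := substFmlStep) rfl]
    change (mkImp (prev body1) (prev body2)).eval _ = _
    rw [mkImp, eval_pair, eval_pair, eval_num, eval_prev_body1 (by decide),
      eval_prev_body2 (by decide), Nat.unpair_pair, ihφ, ihψ, Fml.subst, Fml.code]
  | all i φ ih =>
    rw [Fml.code, eval_cov_switch (G := substFmlStep) rfl]
    change (ite (eqv body1 (comp left prm)) arg (mkAll body1 (prev body2))).eval _ = _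
    rw [eval_ite, mkAll, eval_pair, eval_pair, eval_num, eval_prev_body2 (by decide),
      Nat.unpair_pair, ih]
    by_cases hij : i = j <;> simp [hij, Fml.subst, Fml.code]

/-- The step of the recursion in `freeFor`. -/
def freeForStep : PR :=
  switch tag 0
    [num 1,
     prev body,
     conj (prev body1) (prev body2),
     disj (neg (occFml (comp left prm) arg))
       (conj (neg (occTm body1 (comp right prm))) (prev body2))]

theorem eval_freeFor_ne_zero {t : Tm} {φ : Fml} (ht : u.eval n = t.code)
    (hφ : p.eval n = φ.code) :
    (freeFor k u p).eval n ≠ 0 ↔ φ.FreeFor (k.eval n) t := by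
  change (cov freeForStep).eval (Nat.pair (Nat.pair (k.eval n) (u.eval n)) (p.eval n)) ≠ 0 ↔ _
  rw [ht, hφ]
  generalize k.eval n = j
  clear ht hφ
  induction φ with
  | eq s₁ s₂ =>
    rw [Fml.code, eval_cov_switch (G := freeForStep) rfl]
    exact iff_of_true (by simp) trivial
  | neg φ ih =>
    rw [Fml.code, eval_cov_switch (G := freeForStep) rfl]
    change (prev body).eval _ ≠ 0 ↔ _
    rw [eval_prev_body (by decide), ih, Fml.FreeFor]
  | imp φ ψ ihφ ihψ =>
    rw [Fml.code, eval_cov_switch (G := freeForStep) rfl]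
    change (conj (prev body1) (prev body2)).eval _ ≠ 0 ↔ _
    rw [eval_conj_ne_zero, eval_prev_body1 (by decide), eval_prev_body2 (by decide),
      Nat.unpair_pair, ihφ, ihψ, Fml.FreeFor]
  | all i φ ih =>
    rw [Fml.code, eval_cov_switch (G := freeForStep) rfl]
    change (disj (neg (occFml (comp left prm) arg))
      (conj (neg (occTm body1 (comp right prm))) (prev body2))).eval _ ≠ 0 ↔ _
    -- The free-occurrence test is applied to `arg`, the code of the whole formula `∀ x_i φ`,
    -- matching the first alternative of `FreeFor`.
    rw [eval_disj_ne_zero, eval_neg_ne_zero, eval_conj_ne_zero, eval_neg_ne_zero,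
      eval_prev_body2 (by decide), eval_occFml_ne_zero (φ := .all i φ) (by simp [Fml.code]),
      eval_occTm_ne_zero (t := t) (by simp), eval_body1, Nat.unpair_pair, Nat.unpair_pair, ih,
      eval_comp, eval_prm, eval_left, Nat.unpair_pair, Fml.FreeFor]

end Codes

/-! ### Decoding derivations -/

/-- The step of the recursion in `concl`. -/
def conclStep : PR :=
  switch tag 0
    [guard (conj (isFml body1) (isFml body2))
       (mkImp body1 (mkImp body2 body1)),
     guard (conj (isFml body1) (conj (isFml body21) (isFml body22)))
       (mkImp (mkImp body1 (mkImp body21 body22))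
         (mkImp (mkImp body1 body21) (mkImp body1 body22))),
     guard (conj (isFml body1) (isFml body2))
       (mkImp (mkImp (mkNeg body2) (mkNeg body1)) (mkImp body1 body2)),
     guard (conj (isTm body21) (conj (isFml body22) (freeFor body1 body21 body22)))
       (mkImp (mkAll body1 body22) (substFml body1 body21 body22)),
     guard (conj (isFml body21) (conj (isFml body22) (neg (occFml body1 body21))))
       (mkImp (mkAll body1 (mkImp body21 body22)) (mkImp body21 (mkAll body1 body22))),
     guard (isTm body) (mkEq body body),
     guard (conj (isTm body21) (conj (isTm body221) (conj (isFml body222)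
         (conj (freeFor body1 body21 body222) (freeFor body1 body221 body222)))))
       (mkImp (mkEq body21 body221)
         (mkImp (substFml body1 body21 body222) (substFml body1 body221 body222))),
     guard (eqv body zero) (mkNeg (mkEq (mkSucc (mkVar (num 0))) mkZero)),
     guard (eqv body zero)
       (mkImp (mkEq (mkSucc (mkVar (num 0))) (mkSucc (mkVar (num 1))))
         (mkEq (mkVar (num 0)) (mkVar (num 1)))),
     guard (eqv body zero) (mkEq (mkAdd (mkVar (num 0)) mkZero) (mkVar (num 0))),
     guard (eqv body zero)
       (mkEq (mkAdd (mkVar (num 0)) (mkSucc (mkVar (num 1))))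
         (mkSucc (mkAdd (mkVar (num 0)) (mkVar (num 1))))),
     guard (eqv body zero) (mkEq (mkMul (mkVar (num 0)) mkZero) mkZero),
     guard (eqv body zero)
       (mkEq (mkMul (mkVar (num 0)) (mkSucc (mkVar (num 1))))
         (mkAdd (mkMul (mkVar (num 0)) (mkVar (num 1))) (mkVar (num 0)))),
     guard (isFml body2)
       (mkImp (substFml body1 mkZero body2)
         (mkImp (mkAll body1 (mkImp body2 (substFml body1 (mkSucc (mkVar body1)) body2)))
           (mkAll body1 body2))),
     -- modus ponens: `prev body1` is the conclusion `φ → ψ`, `prev body2` the conclusion `φ`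
     guard (conj (prev body1) (conj (prev body2)
         (conj (eqv (comp left (pred (prev body1))) (num 2))
           (eqv (comp left (comp right (pred (prev body1)))) (pred (prev body2))))))
       (comp right (comp right (pred (prev body1)))),
     guard (prev body2) (mkAll body1 (pred (prev body2)))]

/-- The conclusions computed by `concl` are codes of theorems of Peano Arithmetic. -/
theorem exists_provable_of_concl {f : PR} {n c : ℕ} (h : (concl f).eval n = c + 1) :
    ∃ φ : Fml, φ.code = c ∧ Provable φ := by
  replace h : (cov conclStep).eval (Nat.pair 0 (f.eval n)) = c + 1 := h
  generalize f.eval n = d at h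
  induction d using Nat.strong_induction_on generalizing c with
  | _ d ih =>
    obtain ⟨t, b, rfl⟩ : ∃ t b, d = Nat.pair t b := ⟨_, _, (Nat.pair_unpair d).symm⟩
    rw [eval_cov_switch (G := conclStep) rfl] at h
    have hle {i} (ht : t ≠ 0) (hi : i ≤ b) : i < Nat.pair t b := by
      obtain ⟨t, rfl⟩ := Nat.exists_eq_succ_of_ne_zero ht
      exact hi.trans_lt (lt_pair_succ t b)
    rcases Nat.lt_or_ge t 16 with ht | ht
    swap
    -- Tags from `16` on give the default `0`, which is not a successor.
    · obtain ⟨t, rfl⟩ := Nat.exists_eq_add_of_le' ht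
      exact absurd h.symm (Nat.succ_ne_zero c)
    interval_cases t
    · replace h : (guard _ _).eval _ = c + 1 := h
      simp only [eval_guard_eq_succ, eval_conj_ne_zero] at h
      obtain ⟨⟨hφ, hψ⟩, rfl⟩ := h
      obtain ⟨φ, hφ⟩ := exists_of_isFml hφ
      obtain ⟨ψ, hψ⟩ := exists_of_isFml hψ
      refine ⟨_, ?_, ⟨.ax1 φ ψ⟩⟩
      simp only [mkImp, eval_pair, eval_num, Fml.code, hφ, hψ]
    · replace h : (guard _ _).eval _ = c + 1 := h
      simp only [eval_guard_eq_succ, eval_conj_ne_zero] at h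
      obtain ⟨⟨hφ, hψ, hχ⟩, rfl⟩ := h
      obtain ⟨φ, hφ⟩ := exists_of_isFml hφ
      obtain ⟨ψ, hψ⟩ := exists_of_isFml hψ
      obtain ⟨χ, hχ⟩ := exists_of_isFml hχ
      refine ⟨_, ?_, ⟨.ax2 φ ψ χ⟩⟩
      simp only [mkImp, eval_pair, eval_num, Fml.code, hφ, hψ, hχ]
    · replace h : (guard _ _).eval _ = c + 1 := h
      simp only [eval_guard_eq_succ, eval_conj_ne_zero] at h
      obtain ⟨⟨hφ, hψ⟩, rfl⟩ := h
      obtain ⟨φ, hφ⟩ := exists_of_isFml hφ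
      obtain ⟨ψ, hψ⟩ := exists_of_isFml hψ
      refine ⟨_, ?_, ⟨.ax3 φ ψ⟩⟩
      simp only [mkImp, mkNeg, eval_pair, eval_num, Fml.code, hφ, hψ]
    · replace h : (guard _ _).eval _ = c + 1 := h
      simp only [eval_guard_eq_succ, eval_conj_ne_zero] at h
      obtain ⟨⟨ht, hφ, hf⟩, rfl⟩ := h
      obtain ⟨t, ht⟩ := exists_of_isTm ht
      obtain ⟨φ, hφ⟩ := exists_of_isFml hφ
      rw [eval_freeFor_ne_zero ht hφ] at hf
      refine ⟨_, ?_, ⟨.inst _ t φ hf⟩⟩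
      simp only [mkImp, mkAll, eval_pair, eval_num, Fml.code, hφ, eval_substFml ht hφ]
    · replace h : (guard _ _).eval _ = c + 1 := h
      simp only [eval_guard_eq_succ, eval_conj_ne_zero, eval_neg_ne_zero] at h
      obtain ⟨⟨hφ, hψ, hk⟩, rfl⟩ := h
      obtain ⟨φ, hφ⟩ := exists_of_isFml hφ
      obtain ⟨ψ, hψ⟩ := exists_of_isFml hψ
      rw [eval_occFml_ne_zero hφ] at hk
      refine ⟨_, ?_, ⟨.dist _ φ ψ hk⟩⟩
      simp only [mkImp, mkAll, eval_pair, eval_num, Fml.code, hφ, hψ]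
    · replace h : (guard _ _).eval _ = c + 1 := h
      rw [eval_guard_eq_succ] at h
      obtain ⟨ht, rfl⟩ := h
      obtain ⟨t, ht⟩ := exists_of_isTm ht
      refine ⟨_, ?_, ⟨.refl t⟩⟩
      simp only [mkEq, eval_pair, eval_num, Fml.code, ht]
    · replace h : (guard _ _).eval _ = c + 1 := h
      simp only [eval_guard_eq_succ, eval_conj_ne_zero] at h
      obtain ⟨⟨ht, hu, hφ, hft, hfu⟩, rfl⟩ := h
      obtain ⟨t, ht⟩ := exists_of_isTm ht
      obtain ⟨u, hu⟩ := exists_of_isTm hu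
      obtain ⟨φ, hφ⟩ := exists_of_isFml hφ
      rw [eval_freeFor_ne_zero ht hφ] at hft
      rw [eval_freeFor_ne_zero hu hφ] at hfu
      refine ⟨_, ?_, ⟨.leibniz _ t u φ hft hfu⟩⟩
      simp only [mkImp, mkEq, eval_pair, eval_num, Fml.code, ht, hu, eval_substFml ht hφ,
        eval_substFml hu hφ]
    · replace h : (guard _ _).eval _ = c + 1 := h
      rw [eval_guard_eq_succ] at h
      -- The test that the body is `0` only makes codes of this axiom unique; derivability does not
      -- depend on it.
      obtain ⟨-, rfl⟩ := h
      refine ⟨_, ?_, ⟨.succ_ne_zero⟩⟩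
      simp only [mkNeg, mkEq, eval_pair, eval_num, Fml.code, mkVar, mkZero, mkSucc, Tm.code]
    · replace h : (guard _ _).eval _ = c + 1 := h
      rw [eval_guard_eq_succ] at h
      obtain ⟨-, rfl⟩ := h
      refine ⟨_, ?_, ⟨.succ_inj⟩⟩
      simp only [mkImp, mkEq, eval_pair, eval_num, Fml.code, mkVar, mkSucc, Tm.code]
    · replace h : (guard _ _).eval _ = c + 1 := h
      rw [eval_guard_eq_succ] at h
      obtain ⟨-, rfl⟩ := h
      refine ⟨_, ?_, ⟨.add_zero⟩⟩
      simp only [mkEq, eval_pair, eval_num, Fml.code, mkVar, mkZero, mkAdd, Tm.code]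
    · replace h : (guard _ _).eval _ = c + 1 := h
      rw [eval_guard_eq_succ] at h
      obtain ⟨-, rfl⟩ := h
      refine ⟨_, ?_, ⟨.add_succ⟩⟩
      simp only [mkEq, eval_pair, eval_num, Fml.code, mkVar, mkSucc, mkAdd, Tm.code]
    · replace h : (guard _ _).eval _ = c + 1 := h
      rw [eval_guard_eq_succ] at h
      obtain ⟨-, rfl⟩ := h
      refine ⟨_, ?_, ⟨.mul_zero⟩⟩
      simp only [mkEq, eval_pair, eval_num, Fml.code, mkVar, mkZero, mkMul, Tm.code]
    · replace h : (guard _ _).eval _ = c + 1 := h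
      rw [eval_guard_eq_succ] at h
      obtain ⟨-, rfl⟩ := h
      refine ⟨_, ?_, ⟨.mul_succ⟩⟩
      simp only [mkEq, eval_pair, eval_num, Fml.code, mkVar, mkSucc, mkAdd, mkMul, Tm.code]
    · replace h : (guard _ _).eval _ = c + 1 := h
      rw [eval_guard_eq_succ] at h
      obtain ⟨hφ, rfl⟩ := h
      obtain ⟨φ, hφ⟩ := exists_of_isFml hφ
      -- The substituted terms `0` and `S x_k` are computed by the checker, so they are first
      -- recognized as codes of terms.
      have hz : mkZero.eval (covArg conclStep 0 (Nat.pair 13 b)) = Tm.zero.code := by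
        simp [mkZero, Tm.code]
      have hs : (mkSucc (mkVar body1)).eval (covArg conclStep 0 (Nat.pair 13 b)) =
          (Tm.succ (.var (body1.eval (covArg conclStep 0 (Nat.pair 13 b))))).code := by
        simp [mkSucc, mkVar, Tm.code]
      refine ⟨_, ?_, ⟨.induction (body1.eval (covArg conclStep 0 (Nat.pair 13 b))) φ⟩⟩
      simp only [mkImp, mkAll, eval_pair, eval_num, Fml.code, hφ, eval_substFml hz hφ,
        eval_substFml hs hφ]
    · replace h : (guard _ _).eval _ = c + 1 := h
      simp only [eval_guard_eq_succ, eval_conj_ne_zero, eval_eqv_ne_zero, eval_comp, eval_pred,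
        eval_num, eval_left, eval_right, eval_prev_body1 (G := conclStep) (t := 14) (by decide),
        eval_prev_body2 (G := conclStep) (t := 14) (by decide)] at h
      obtain ⟨⟨h₁, h₂, h2, hφ⟩, rfl⟩ := h
      -- A nonzero output is the code of a conclusion plus one, the form required by the induction
      -- hypothesis.
      obtain ⟨c₁, h₁⟩ := Nat.exists_eq_succ_of_ne_zero h₁
      obtain ⟨c₂, h₂⟩ := Nat.exists_eq_succ_of_ne_zero h₂
      obtain ⟨χ, rfl, ⟨d⟩⟩ := ih _ (hle (by decide) (Nat.unpair_left_le b)) h₁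
      obtain ⟨φ, rfl, ⟨e⟩⟩ := ih _ (hle (by decide) (Nat.unpair_right_le b)) h₂
      rw [h₁, Nat.succ_sub_one] at h2 hφ ⊢
      rw [h₂, Nat.succ_sub_one] at hφ
      -- The tag `2` leaves only implications as major premise.
      cases χ <;> simp [Fml.code] at h2
      simp only [Fml.code, Nat.unpair_pair] at hφ ⊢
      obtain rfl := Fml.code_injective hφ
      exact ⟨_, rfl, ⟨.mp d e⟩⟩
    · replace h : (guard _ _).eval _ = c + 1 := h
      simp only [eval_guard_eq_succ, mkAll, eval_pair, eval_pred, eval_num,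
        eval_prev_body2 (G := conclStep) (t := 15) (by decide)] at h
      obtain ⟨h₂, rfl⟩ := h
      obtain ⟨c₂, h₂⟩ := Nat.exists_eq_succ_of_ne_zero h₂
      obtain ⟨φ, rfl, ⟨e⟩⟩ := ih _ (hle (by decide) (Nat.unpair_right_le b)) h₂
      exact ⟨_, by rw [h₂, Nat.succ_sub_one, Fml.code], ⟨.gen _ e⟩⟩

end PR

/-! ### From the truth of the verified sentence to derivability -/

/-- The proof predicate holds only of codes of theorems of Peano Arithmetic. -/
theorem provable_of_proofChar {p : ℕ} {φ : Fml}
    (h : PR.proofChar.eval (Nat.pair p φ.code) = 1) : Provable φ := by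
  have h' : (PR.concl .left).eval (Nat.pair p φ.code) = φ.code + 1 := by
    have := (PR.eval_eqv_ne_zero _ _ _).1 (show PR.proofChar.eval _ ≠ 0 by rw [h]; decide)
    simpa using this
  obtain ⟨ψ, hψ, hp⟩ := PR.exists_provable_of_concl h'
  exact Fml.code_injective hψ ▸ hp

/-- Peano Arithmetic is consistent, since its theorems are true in the standard model. -/
theorem not_provable_bot : ¬ Provable .bot := fun ⟨d⟩ => by
  simpa [Fml.bot, Tm.val] using d.sound fun _ => 0

theorem SerialProperty.SelectorProvable.provable {F : SerialProperty} (hF : F.SelectorProvable)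
    (n : ℕ) : Provable (F.inst n) := by
  obtain ⟨s, v⟩ := hF
  -- Truth of the universal sentence is instantiated at `x₀ = n`; the underlying assignment is
  -- arbitrary.
  have h := proofChar_eval_of_sat_proofOf (v.sound (fun _ => 0) n)
  rw [Function.update_self, F.name_eval] at h
  exact provable_of_proofChar h

end PeanoArith

theorem corollary2 :
    (∀ F : PeanoArith.SerialProperty, F.SelectorProvable →
      ∀ n : ℕ, PeanoArith.Provable (F.inst n)) ∧
    (∀ F : PeanoArith.SerialProperty, (∃ n : ℕ, F.inst n = PeanoArith.Fml.bot) →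
      ¬ F.SelectorProvable) :=
  ⟨fun _ hF => hF.provable,
    fun _ ⟨n, hn⟩ hF => PeanoArith.not_provable_bot (hn ▸ hF.provable n)⟩
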